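/- Let $A$ be a closed, densely defined, symmetric operator in a complex Hilbert space $\mathcal H$ and let $T\subset A^*$ be a linear operator with $\overline T=A^*$. Inner products $(\cdot,\cdot)$ are linear in the first entry. Let $\{\mathcal G,\Gamma_0,\Gamma_1\}$ be a quasi boundary triple for $T\subset A^*$, i.e. $\mathcal G$ is a Hilbert space and $\Gamma_0,\Gamma_1:\operatorname{dom}T\to\mathcal G$ are linear maps such that $(Tf,g)-(f,Tg)=(\Gamma_1f,\Gamma_0g)-(\Gamma_0f,\Gamma_1g)$ for all $f,g\in\operatorname{dom}T$, $\operatorname{ran}(\Gamma_0,\Gamma_1)$ is dense in $\mathcal G\times\mathcal G$, and $A_0:=T\upharpoonright\ker\Gamma_0$ is self-adjoint. Assume in addition that $A_1:=T\upharpoonright\ker\Gamma_1$ is self-adjoint, that $\eta\in\rho(A_0)\cap\rho(A_1)\cap\mathbb R$, and that the spaces $$\mathscr G_0:=\operatorname{ran}(\Gamma_0\upharpoonright\ker\Gamma_1),\qquad \mathscr G_1:=\operatorname{ran}(\Gamma_1\upharpoonright\ker\Gamma_0)$$ are dense in $\mathcal G$. Equip $\mathscr G_0$ and $\mathscr G_1$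 with norms that make them reflexive Banach spaces continuously embedded in $\mathcal G$ and such that $\Gamma_1(A_0-\bar\lambda)^{-1}:\mathcal H\to\mathscr G_1$ is continuous for some $\lambda\in\rho(A_0)$ and $\Gamma_0(A_1-\bar\mu)^{-1}:\mathcal H\to\mathscr G_0$ is continuous for some $\mu\in\rho(A_1)$. Let $\mathscr G_j'$ be the antidual of $\mathscr G_j$, and regard $\mathscr G_j\subset\mathcal G\subset\mathscr G_j'$, where $x\in\mathcal G$ acts as $y\mapsto(x,y)$. Let $\iota_+:\mathscr G_1\to\mathcal G$ and $\iota_-:\mathscr G_1'\to\mathcal G$ be (for instance isometric) isomorphisms with $(\iota_-x',\iota_+x)=\langle x',x\rangle$ for all $x\in\mathscr G_1$, $x'\in\mathscr G_1'$. With respect to the graph norm on $\operatorname{dom}A^*$, let $\widetilde\Gamma_0:\operatorname{dom}A^*\to\mathscr G_1'$ and $\widetilde\Gamma_1:\operatorname{dom}A^*\to\mathscr G_0'$ be the extensions by continuity of $\Gamma_0$ and $\Gamma_1$, put $\widetilde\Gamma=(\widetilde\Gamma_0,\widetilde\Gamma_1)$, and let $\widetilde M(\eta)=\widetilde\Gamma_1\bigl(\widetilde\Gamma_0\upharpoonright\ker(A^*-\eta)\bigr)^{-1}$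 be the extended Weyl function at $\eta$. Then these objects are well defined: $\widetilde\Gamma_0,\widetilde\Gamma_1$ extend $\Gamma_0,\Gamma_1$, and $\widetilde M(\eta)$ is an operator defined on all of $\mathscr G_1'$ with values in $\mathscr G_0'$. Moreover, the following holds. 1. The mapping $$\Theta\mapsto\widetilde A_\vartheta=A^*\upharpoonright\{f\in\operatorname{dom}A^*:\widetilde\Gamma f\in\vartheta\},\qquad \vartheta=\iota_+^{-1}\Theta\iota_-+\widetilde M(\eta),$$ (products and sums in the sense of linear relations, $\vartheta\subset\mathscr G_1'\times\mathscr G_0'$) is a bijection from the set of all closed linear relations $\Theta$ in $\mathcal G$ onto the set of all closed operators $B$ with $A\subset B\subset A^*$. For each of the properties symmetric, self-adjoint, dissipative, maximal dissipative, accumulative, maximal accumulative, it is also a bijection from the set of all linear relations in $\mathcal G$ with this property onto the set of all operators $B$ with this property such that $A\subset B\subset A^*$, and likewise from the closed relations with this property onto the closed operators $B$ with this property such that $A\subset B\subset A^*$. 2. If $\Theta$ is a linear relation in $\mathcal G$ and $S$ is an operator in $\mathcal H$ with $T\subset S\subset A^*$, then $$\operatorname{dom}\Theta\subset\operatorname{ran}\bigl(\iota_-\widetilde\Gamma_0\upharpoonright\operatorname{dom}S\bigr)\quad\text{implies}\quad\operatorname{dom}\widetilde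 A_\vartheta\subset\operatorname{dom}S.$$ Here a linear relation $\Theta$ in a Hilbert space is a linear subspace of its square, $\Theta^*=\{(y,y'):(x',y)=(x,y')\text{ for all }(x,x')\in\Theta\}$, $\Theta$ is symmetric if $\Theta\subset\Theta^*$, self-adjoint if $\Theta=\Theta^*$, dissipative (accumulative) if $\operatorname{Im}(x',x)\ge0$ ($\le0$) for all $(x,x')\in\Theta$, and maximal dissipative (maximal accumulative) if in addition it has no proper dissipative (accumulative) linear relation extension; operators are identified with their graphs. -/

import Mathlib

open scoped ComplexConjugate

namespace BoundaryTriple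

noncomputable section

/-! Inner products: the pairing `(x, y)`, linear in `x` and antilinear in `y`, is `inner ℂ y x`. -/

/-! ### Linear relations

A linear relation from `E` to `F` is a linear subspace of `E × F`; an operator is identified with
its graph. The adjoint relation is Mathlib's `Submodule.adjoint`. -/

section Relations

variable {E F K L : Type*} [AddCommGroup E] [Module ℂ E] [AddCommGroup F] [Module ℂ F]
  [AddCommGroup K] [Module ℂ K] [AddCommGroup L] [Module ℂ L]

/-- The domain of a linear relation. -/
def relDom (R : Submodule ℂ (E × F)) : Submodule ℂ E :=
  R.map (LinearMap.fst ℂ E F)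

/-- The sum of two linear relations: all `(x, y + z)` with `(x, y) ∈ R` and `(x, z) ∈ S`. -/
def relAdd (R S : Submodule ℂ (E × F)) : Submodule ℂ (E × F) where
  carrier := {p | ∃ y z, (p.1, y) ∈ R ∧ (p.1, z) ∈ S ∧ p.2 = y + z}
  zero_mem' := ⟨0, 0, R.zero_mem, S.zero_mem, by simp⟩
  add_mem' := by
    rintro p q ⟨y, z, hy, hz, h⟩ ⟨y', z', hy', hz', h'⟩
    refine ⟨y + y', z + z', R.add_mem hy hy', S.add_mem hz hz', ?_⟩
    simp only [Prod.snd_add, h, h']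
    abel
  smul_mem' := by
    rintro c p ⟨y, z, hy, hz, h⟩
    exact ⟨c • y, c • z, R.smul_mem c hy, S.smul_mem c hz, by simp [h]⟩

/-- For a relation `Θ` in `L`, a map `u : E → L` and a map `v : L → F`, the product relation
`v Θ u`: all `(x, v y)` with `(u x, y) ∈ Θ`. -/
def relSandwich (v : L →ₗ[ℂ] F) (Θ : Submodule ℂ (L × L)) (u : E →ₗ[ℂ] L) :
    Submodule ℂ (E × F) where
  carrier := {p | ∃ y, (u p.1, y) ∈ Θ ∧ p.2 = v y}
  zero_mem' := ⟨0, by rw [Prod.fst_zero, map_zero]; exact Θ.zero_mem, by simp⟩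
  add_mem' := by
    rintro p q ⟨y, hy, h⟩ ⟨y', hy', h'⟩
    exact ⟨y + y', by simpa using Θ.add_mem hy hy', by simp [h, h']⟩
  smul_mem' := by
    rintro c p ⟨y, hy, h⟩
    exact ⟨c • y, by simpa using Θ.smul_mem c hy, by simp [h]⟩

end Relations

section Kinds

variable {E : Type*} [NormedAddCommGroup E] [InnerProductSpace ℂ E]

/-- A linear relation is symmetric if it is contained in its adjoint. -/
def RelSymmetric (R : Submodule ℂ (E × E)) : Prop := R ≤ R.adjoint

/-- A linear relation is self-adjoint if it equals its adjoint. -/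
def RelSelfAdjoint (R : Submodule ℂ (E × E)) : Prop := R = R.adjoint

/-- `Im (x', x) ≥ 0` for all `(x, x') ∈ R`. -/
def RelDissipative (R : Submodule ℂ (E × E)) : Prop :=
  ∀ p ∈ R, 0 ≤ (inner ℂ p.1 p.2).im

/-- `Im (x', x) ≤ 0` for all `(x, x') ∈ R`. -/
def RelAccumulative (R : Submodule ℂ (E × E)) : Prop :=
  ∀ p ∈ R, (inner ℂ p.1 p.2).im ≤ 0

/-- Dissipative, without proper dissipative extension. -/
def RelMaxDissipative (R : Submodule ℂ (E × E)) : Prop :=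
  RelDissipative R ∧ ∀ S : Submodule ℂ (E × E), RelDissipative S → R ≤ S → S = R

/-- Accumulative, without proper accumulative extension. -/
def RelMaxAccumulative (R : Submodule ℂ (E × E)) : Prop :=
  RelAccumulative R ∧ ∀ S : Submodule ℂ (E × E), RelAccumulative S → R ≤ S → S = R

end Kinds

/-- The seven kinds of linear relations (and, through graphs, of operators) considered. -/
inductive RelKind
  | closed
  | symmetric
  | selfAdjoint
  | dissipative
  | maxDissipative
  | accumulative
  | maxAccumulative

/-- The linear relation `R` is of the given kind. -/
def RelKind.Holds {E : Type*} [NormedAddCommGroup E] [InnerProductSpace ℂ E]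
    (k : RelKind) (R : Submodule ℂ (E × E)) : Prop :=
  match k with
  | .closed => IsClosed (R : Set (E × E))
  | .symmetric => RelSymmetric R
  | .selfAdjoint => RelSelfAdjoint R
  | .dissipative => RelDissipative R
  | .maxDissipative => RelMaxDissipative R
  | .accumulative => RelAccumulative R
  | .maxAccumulative => RelMaxAccumulative R

/-! ### Quasi boundary triples -/

section Triples

variable {H : Type*} [NormedAddCommGroup H] [InnerProductSpace ℂ H]

/-- The resolvent set: those `z` for which `B - z : dom B → H` is bijective with a bounded
inverse `R`. -/
def resolventSet (B : H →ₗ.[ℂ] H) : Set ℂ :=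
  {z | ∃ R : H →L[ℂ] H, (∀ g, ∃ h : R g ∈ B.domain, B ⟨R g, h⟩ - z • R g = g) ∧
    ∀ f : B.domain, R (B f - z • (f : H)) = f}

variable {G : Type*} [NormedAddCommGroup G] [InnerProductSpace ℂ G]

/-- The restriction of the operator `T` to the kernel of `Γ : dom T → G`. -/
def restrictKer (T : H →ₗ.[ℂ] H) (Γ : T.domain →ₗ[ℂ] G) : H →ₗ.[ℂ] H :=
  T.domRestrict ((LinearMap.ker Γ).map T.domain.subtype)

/-- A quasi boundary triple `{G, Γ₀, Γ₁}` for `T ⊆ A*`, where `T` is dense in `A*`. -/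
structure QuasiBoundaryTriple [CompleteSpace H] (A T : H →ₗ.[ℂ] H) (G : Type*)
    [NormedAddCommGroup G] [InnerProductSpace ℂ G] where
  le_adjoint : T ≤ A.adjoint
  closure_eq : T.closure = A.adjoint
  Γ₀ : T.domain →ₗ[ℂ] G
  Γ₁ : T.domain →ₗ[ℂ] G
  green : ∀ f g : T.domain, inner ℂ (g : H) (T f) - inner ℂ (T g) (f : H) =
    inner ℂ (Γ₀ g) (Γ₁ f) - inner ℂ (Γ₁ g) (Γ₀ f)
  denseRange : DenseRange fun f : T.domain => (Γ₀ f, Γ₁ f)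
  selfAdjoint : IsSelfAdjoint (restrictKer T Γ₀)

variable {X : Type*} [NormedAddCommGroup X] [NormedSpace ℂ X]

/-- The embedding of `G` into the antidual `X →L⋆[ℂ] ℂ` of a space `X` that is continuously embedded
in `G` by `j`: the vector `x` is sent to the antilinear functional `y ↦ (x, j y)`. -/
def toAntidual (j : X →L[ℂ] G) : G →ₗ[ℂ] (X →L⋆[ℂ] ℂ) where
  toFun x := ((innerSL ℂ).flip x).comp j
  map_add' x y := by ext; simp
  map_smul' c x := by ext; simp

/-- `X`, embedded in `G` by `j`, is the space `ran (Γ' ↾ ker Γ)` equipped with a norm such that it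
is a reflexive Banach space continuously embedded in `G` (completeness of `X` is assumed
separately) and such that the operator `Γ' (B - conj z)⁻¹ : H → X`, where `B` is the restriction of
`T` to `ker Γ`, is continuous for some `z` in the resolvent set of `B`; this operator is `K`. -/
structure IsAdmissible {T : H →ₗ.[ℂ] H} (Γ Γ' : T.domain →ₗ[ℂ] G) (j : X →L[ℂ] G) : Prop where
  injective : Function.Injective j
  range_eq : LinearMap.range (j : X →ₗ[ℂ] G) = (LinearMap.ker Γ).map Γ'
  reflexive : Function.Surjective (NormedSpace.inclusionInDoubleDual ℂ X)
  continuous_resolvent : ∃ z ∈ resolventSet (restrictKer T Γ), ∃ K : H →L[ℂ] X,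
    ∀ f : T.domain, Γ f = 0 → j (K (T f - conj z • (f : H))) = Γ' f

namespace QuasiBoundaryTriple

variable [CompleteSpace H] {A T : H →ₗ.[ℂ] H} (q : QuasiBoundaryTriple A T G)

/-- The inclusion of `dom T` in `dom A*`; the latter with the graph norm is the space
`A.adjoint.graph`, a subspace of `H × H`. -/
def incl : T.domain →ₗ[ℂ] A.adjoint.graph where
  toFun f := ⟨((f : H), T f), LinearPMap.le_graph_of_le q.le_adjoint (T.mem_graph f)⟩
  map_add' f g := by ext <;> simp [LinearPMap.map_add]
  map_smul' c f := by ext <;> simp [LinearPMap.map_smul]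

/-- The continuous extension to `dom A*`, with the graph norm, of a boundary map `Γ`
regarded as a map from `dom T` to the antidual of `X`. -/
def extendBoundaryMap (Γ : T.domain →ₗ[ℂ] G) (j : X →L[ℂ] G) :
    A.adjoint.graph →L[ℂ] (X →L⋆[ℂ] ℂ) :=
  ((toAntidual j).comp Γ).extendOfNorm q.incl

variable {X₀ X₁ : Type*} [NormedAddCommGroup X₀] [NormedSpace ℂ X₀]
  [NormedAddCommGroup X₁] [NormedSpace ℂ X₁]

/-- The extended boundary map `Γ̃₀ : dom A* → X₁'`. -/
def extΓ₀ (j₁ : X₁ →L[ℂ] G) : A.adjoint.graph →L[ℂ] (X₁ →L⋆[ℂ] ℂ) :=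
  q.extendBoundaryMap q.Γ₀ j₁

/-- The extended boundary map `Γ̃₁ : dom A* → X₀'`. -/
def extΓ₁ (j₀ : X₀ →L[ℂ] G) : A.adjoint.graph →L[ℂ] (X₀ →L⋆[ℂ] ℂ) :=
  q.extendBoundaryMap q.Γ₁ j₀

/-- The extended boundary map `Γ̃ = (Γ̃₀, Γ̃₁)`. -/
def extΓ (j₀ : X₀ →L[ℂ] G) (j₁ : X₁ →L[ℂ] G) :
    A.adjoint.graph →ₗ[ℂ] (X₁ →L⋆[ℂ] ℂ) × (X₀ →L⋆[ℂ] ℂ) :=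
  ((q.extΓ₀ j₁).prod (q.extΓ₁ j₀)).toLinearMap

/-- The value at `z` of the extended Weyl function, `M̃(z) = Γ̃₁ (Γ̃₀ ↾ ker (A* - z))⁻¹`, as a
linear relation: all `(Γ̃₀ f, Γ̃₁ f)` with `f ∈ dom A*`, `A* f = z f`. -/
def extWeyl (j₀ : X₀ →L[ℂ] G) (j₁ : X₁ →L[ℂ] G) (z : ℂ) :
    Submodule ℂ ((X₁ →L⋆[ℂ] ℂ) × (X₀ →L⋆[ℂ] ℂ)) :=
  (LinearMap.ker ((LinearMap.snd ℂ H H - z • LinearMap.fst ℂ H H).comp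
    A.adjoint.graph.subtype)).map (q.extΓ j₀ j₁)

/-- The parameter `ϑ = ι₊⁻¹ Θ ι₋ + M̃(η)`, a linear relation from `X₁'` to `X₀'`, where
`ι₊⁻¹ Θ ι₋ ⊆ X₁' × X₁` and `X₁ ⊆ G ⊆ X₀'`. -/
def param (j₀ : X₀ →L[ℂ] G) (j₁ : X₁ →L[ℂ] G) (ιp : X₁ ≃L[ℂ] G) (ιm : (X₁ →L⋆[ℂ] ℂ) ≃L[ℂ] G)
    (η : ℂ) (Θ : Submodule ℂ (G × G)) : Submodule ℂ ((X₁ →L⋆[ℂ] ℂ) × (X₀ →L⋆[ℂ] ℂ)) :=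
  relAdd
    (relSandwich ((toAntidual j₀).comp ((j₁ : X₁ →ₗ[ℂ] G).comp (ιp.symm : G →ₗ[ℂ] X₁))) Θ
      (ιm : (X₁ →L⋆[ℂ] ℂ) →ₗ[ℂ] G))
    (q.extWeyl j₀ j₁ η)

/-- The restriction of `A*` to all `f ∈ dom A*` with `Γ̃ f ∈ ϑ`. -/
def extension (j₀ : X₀ →L[ℂ] G) (j₁ : X₁ →L[ℂ] G)
    (ϑ : Submodule ℂ ((X₁ →L⋆[ℂ] ℂ) × (X₀ →L⋆[ℂ] ℂ))) : H →ₗ.[ℂ] H :=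
  A.adjoint.domRestrict
    ((ϑ.comap (q.extΓ j₀ j₁)).map ((LinearMap.fst ℂ H H).comp A.adjoint.graph.subtype))

end QuasiBoundaryTriple

end Triples

end

end BoundaryTriple

/-! The regularized map `Υ f = (ι₋ Γ̃₀ f, ι₊ Γ₁ (A₀ - η)⁻¹ (A* - η) f)` (`ordinaryMap`) is an
ordinary boundary triple for `A*`: it is continuous for the graph norm, maps onto `G × G`, has
kernel `A` and satisfies Green's identity (`isBoundaryMap_ordinaryMap`). Here `Γ̃₀` has kernel `dom
A₀`, and Riesz representation shows that it maps `ker (A* - η)` onto all of `X₁'`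
(`extΓ₀_eq_zero_iff`, `exists_extΓ₀_eq`).

Consequently each `f ∈ dom A*` splits as `f₀ + f_η` with `f₀ ∈ dom A₀` and `f_η ∈ ker (A* - η)`, and
`Γ̃₁ f - M̃(η) Γ̃₀ f = Γ₁ f₀`. Up to `ι₊` the right side is the second component of `Υ f`, so `Γ̃ f
∈ ϑ` if and only if `Υ f ∈ Θ` (`extΓ_mem_param_iff`).

What remains is the theory of ordinary triples: `Θ ↦ Υ⁻¹ Θ` is an order isomorphism onto the
relations between `A` and `A*`, all of which are operators. It commutes with adjoints, preserves `Im
(x', x)` and, by the open mapping theorem, preserves and reflects closedness (`holds_iff`). The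
regularity statement holds because two elements with the same `Γ̃₀` differ by an element of `dom A₀
⊆ dom T`. -/

namespace BoundaryTriple

/-! ### Ordinary boundary maps: transfer of properties between `G` and `H`. -/

section Transfer

variable {H G : Type*} [NormedAddCommGroup H] [InnerProductSpace ℂ H]
  [NormedAddCommGroup G] [InnerProductSpace ℂ G]

/-- The double adjoint of a closed linear relation is contained in the relation. -/
theorem adjoint_adjoint_le [CompleteSpace H] (R : Submodule ℂ (H × H))
    (hR : IsClosed (R : Set (H × H))) : R.adjoint.adjoint ≤ R := by
  intro p hp
  set e := WithLp.prodContinuousLinearEquiv 2 ℂ H H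
  set R' : Submodule ℂ (WithLp 2 (H × H)) := R.comap (e : WithLp 2 (H × H) →ₗ[ℂ] H × H)
  have hR' : IsClosed (R' : Set (WithLp 2 (H × H))) := hR.preimage e.continuous
  have : CompleteSpace R' := hR'.completeSpace_coe
  -- The adjoint is the orthogonal complement rotated by `(x, y) ↦ (y, -x)`, so the double adjoint
  -- is the double orthogonal complement in the Hilbert space `WithLp 2 (H × H)`.
  have key : e.symm p ∈ R'ᗮᗮ := by
    intro v hv
    have h1 : (v.snd, -v.fst) ∈ R.adjoint := by
      rw [Submodule.mem_adjoint_iff]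
      intro a b hab
      have := hv (WithLp.toLp 2 (a, b)) hab
      simp only [WithLp.prod_inner_apply] at this
      simp only [inner_neg_right, sub_neg_eq_add]
      rw [add_comm]; exact this
    have h2 := (Submodule.mem_adjoint_iff _ _).1 hp _ _ h1
    simp only [WithLp.prod_inner_apply]
    rw [inner_neg_left] at h2
    change inner ℂ v.fst p.1 + inner ℂ v.snd p.2 = 0
    linear_combination -h2
  rw [Submodule.orthogonal_orthogonal] at key
  simpa [R'] using key

/-- A relation on which `σ Im (x', x)` is nonnegative and which extends a symmetric relation is
contained in the adjoint of the latter. -/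
theorem le_adjoint_of_semidefinite {S R : Submodule ℂ (H × H)} (hS : S ≤ S.adjoint) {σ : ℝ}
    (hσ : σ ≠ 0) (hR : ∀ p ∈ R, 0 ≤ σ * (inner ℂ p.1 p.2).im) (hSR : S ≤ R) :
    R ≤ S.adjoint := by
  intro p hp
  rw [Submodule.mem_adjoint_iff]
  intro a b hab
  set w := inner ℂ b p.1 - inner ℂ a p.2 with hw
  have hab0 : (inner ℂ a b).im = 0 := by
    have h := (Submodule.mem_adjoint_iff _ _).1 (hS hab) a b hab
    have h2 := congrArg Complex.im h
    rw [← inner_conj_symm b a] at h2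
    simp only [Complex.sub_im, Complex.conj_im, Complex.zero_im] at h2
    linarith
  -- The quadratic term in `c` vanishes because `inner ℂ a b` is real, so the form is real affine in
  -- `c` and is unbounded unless `w = 0`.
  have key : ∀ c : ℂ, (inner ℂ (p + c • (a, b)).1 (p + c • (a, b)).2).im =
      (inner ℂ p.1 p.2).im - (conj c * w).im := by
    intro c
    have e1 : inner ℂ p.1 b = conj (inner ℂ b p.1) := (inner_conj_symm _ _).symm
    simp only [Prod.fst_add, Prod.snd_add, Prod.smul_fst, Prod.smul_snd, inner_add_left,
      inner_add_right, inner_smul_left, inner_smul_right, e1, hw]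
    simp only [Complex.add_im, Complex.add_re, Complex.mul_im, Complex.mul_re, Complex.conj_im, Complex.conj_re,
      Complex.sub_re, Complex.sub_im, hab0]
    ring
  by_contra hne
  have hpos : Complex.normSq w ≠ 0 := by simpa using hne
  -- Chosen so that the perturbed vector has `σ Im (x', x) = -1`.
  set t : ℝ := (σ * (inner ℂ p.1 p.2).im + 1) / (σ * Complex.normSq w) with ht
  have h := hR _ (R.add_mem hp (R.smul_mem (conj ((t : ℂ) * Complex.I * conj w)) (hSR hab)))
  rw [key, Complex.conj_conj, mul_assoc, mul_comm (conj w) w, Complex.mul_conj] at h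
  have e : ((t : ℂ) * Complex.I * (Complex.normSq w : ℂ)).im = t * Complex.normSq w := by simp
  rw [e] at h
  have e2 : σ * (t * Complex.normSq w) = σ * (inner ℂ p.1 p.2).im + 1 := by
    rw [ht]; field_simp
  rw [mul_sub, e2] at h
  linarith

/-- The inverse image of a relation under a boundary map, as a relation in `H`. -/
def preRel {N : Submodule ℂ (H × H)} (Υ : N →L[ℂ] G × G) (Θ : Submodule ℂ (G × G)) :
    Submodule ℂ (H × H) :=
  (Θ.comap (Υ : N →ₗ[ℂ] G × G)).map N.subtype

theorem mem_preRel {N : Submodule ℂ (H × H)} {Υ : N →L[ℂ] G × G} {Θ : Submodule ℂ (G × G)}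
    {p : H × H} : p ∈ preRel Υ Θ ↔ ∃ h : p ∈ N, Υ ⟨p, h⟩ ∈ Θ := by
  simp [preRel, Submodule.mem_map]

/-- An abstract boundary map for the adjoint `N` of a symmetric relation `S`: a continuous
surjection of `N` onto `G × G` with kernel `S` which satisfies Green's identity. -/
structure IsBoundaryMap (S N : Submodule ℂ (H × H)) (Υ : N →L[ℂ] G × G) : Prop where
  eq_adjoint : N = S.adjoint
  le : S ≤ N
  surjective : Function.Surjective Υ
  ker_iff : ∀ p : N, Υ p = 0 ↔ (p : H × H) ∈ S
  green : ∀ f g : N, inner ℂ (g : H × H).1 (f : H × H).2 - inner ℂ (g : H × H).2 (f : H × H).1 =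
    inner ℂ (Υ g).1 (Υ f).2 - inner ℂ (Υ g).2 (Υ f).1

namespace IsBoundaryMap

variable {S N : Submodule ℂ (H × H)} {Υ : N →L[ℂ] G × G} (h : IsBoundaryMap S N Υ)
include h

theorem preRel_le_iff {Θ Θ' : Submodule ℂ (G × G)} : preRel Υ Θ ≤ preRel Υ Θ' ↔ Θ ≤ Θ' := by
  unfold preRel
  rw [Submodule.map_le_map_iff_of_injective N.injective_subtype,
    Submodule.comap_le_comap_iff_of_surjective h.surjective]

theorem preRel_injective : Function.Injective (preRel Υ) := fun _ _ e =>
  le_antisymm (h.preRel_le_iff.1 e.le) (h.preRel_le_iff.1 e.ge)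

theorem le_preRel (Θ : Submodule ℂ (G × G)) : S ≤ preRel Υ Θ := fun p hp =>
  mem_preRel.2 ⟨h.le hp, by rw [(h.ker_iff ⟨p, h.le hp⟩).2 hp]; exact Θ.zero_mem⟩

omit h in
theorem preRel_le (Θ : Submodule ℂ (G × G)) : preRel Υ Θ ≤ N := fun _ hp => (mem_preRel.1 hp).1

theorem exists_preRel_eq {R : Submodule ℂ (H × H)} (hS : S ≤ R) (hN : R ≤ N) :
    ∃ Θ, preRel Υ Θ = R := by
  refine ⟨(R.comap N.subtype).map (Υ : N →ₗ[ℂ] G × G), le_antisymm ?_ ?_⟩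
  · intro p hp
    obtain ⟨hpN, r, hr, e⟩ := mem_preRel.1 hp
    -- Two elements with the same boundary value differ by an element of `S`, which is contained in
    -- `R`.
    have h0 : Υ (⟨p, hpN⟩ - r) = 0 := by rw [map_sub, ← e]; exact sub_self _
    have := R.add_mem (hS ((h.ker_iff _).1 h0)) hr
    simpa using this
  · intro p hp
    exact mem_preRel.2 ⟨hN hp, ⟨p, hN hp⟩, hp, rfl⟩

/-- Since the preimage contains `S`, its adjoint lies in `S.adjoint = N`. On `N` Green's identity
matches the two pairings, and surjectivity lifts every pair of `Θ`. -/
theorem preRel_adjoint (Θ : Submodule ℂ (G × G)) :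
    (preRel Υ Θ).adjoint = preRel Υ Θ.adjoint := by
  ext p
  rw [mem_preRel]
  constructor
  · intro hp
    have hpN : p ∈ N := by
      rw [h.eq_adjoint, Submodule.mem_adjoint_iff]
      exact fun a b hab => (Submodule.mem_adjoint_iff _ _).1 hp a b (h.le_preRel Θ hab)
    refine ⟨hpN, (Submodule.mem_adjoint_iff _ _).2 fun a b hab => ?_⟩
    obtain ⟨q, hq⟩ := h.surjective (a, b)
    have h1 := (Submodule.mem_adjoint_iff _ _).1 hp q.1.1 q.1.2
      (mem_preRel.2 ⟨q.2, by rw [← hq] at hab; exact hab⟩)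
    have h2 := h.green ⟨p, hpN⟩ q
    rw [hq] at h2
    simp only at h2
    linear_combination h1 + h2
  · rintro ⟨hpN, hp⟩
    refine (Submodule.mem_adjoint_iff _ _).2 fun a b hab => ?_
    obtain ⟨hq, hqΘ⟩ := mem_preRel.1 hab
    have h1 := (Submodule.mem_adjoint_iff _ _).1 hp _ _ hqΘ
    have h2 := h.green ⟨p, hpN⟩ ⟨_, hq⟩
    simp only at h2
    linear_combination h1 - h2

theorem im_inner_eq (p : N) :
    (inner ℂ (p : H × H).1 (p : H × H).2).im = (inner ℂ (Υ p).1 (Υ p).2).im := by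
  have := congrArg Complex.im (h.green p p)
  rw [← inner_conj_symm (p : H × H).2, ← inner_conj_symm (Υ p).2] at this
  simp only [Complex.sub_im, Complex.conj_im] at this
  linarith

theorem semidefinite_iff (σ : ℝ) (Θ : Submodule ℂ (G × G)) :
    (∀ p ∈ preRel Υ Θ, 0 ≤ σ * (inner ℂ p.1 p.2).im) ↔
      ∀ p ∈ Θ, 0 ≤ σ * (inner ℂ p.1 p.2).im := by
  constructor
  · intro hR p hp
    obtain ⟨q, rfl⟩ := h.surjective p
    rw [← h.im_inner_eq]
    exact hR q (mem_preRel.2 ⟨q.2, hp⟩)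
  · intro hΘ p hp
    obtain ⟨hpN, hpΘ⟩ := mem_preRel.1 hp
    rw [h.im_inner_eq ⟨p, hpN⟩]
    exact hΘ _ hpΘ

/-- A competing extension in `H` is not assumed to lie in `N`, but it extends the symmetric `S`, so
`le_adjoint_of_semidefinite` puts it there and makes it a preimage. The signs `σ = 1` and `σ = -1`
give the dissipative and accumulative cases. -/
theorem maximal_semidefinite_iff {σ : ℝ} (hσ : σ ≠ 0) (Θ : Submodule ℂ (G × G)) :
    ((∀ p ∈ preRel Υ Θ, 0 ≤ σ * (inner ℂ p.1 p.2).im) ∧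
      ∀ R : Submodule ℂ (H × H), (∀ p ∈ R, 0 ≤ σ * (inner ℂ p.1 p.2).im) →
        preRel Υ Θ ≤ R → R = preRel Υ Θ) ↔
    ((∀ p ∈ Θ, 0 ≤ σ * (inner ℂ p.1 p.2).im) ∧
      ∀ R : Submodule ℂ (G × G), (∀ p ∈ R, 0 ≤ σ * (inner ℂ p.1 p.2).im) →
        Θ ≤ R → R = Θ) := by
  rw [h.semidefinite_iff]
  refine and_congr_right fun _ => ⟨fun hmax R hR hle => ?_, fun hmax R hR hle => ?_⟩
  · exact h.preRel_injective (hmax _ ((h.semidefinite_iff σ R).2 hR) (h.preRel_le_iff.2 hle))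
  · have hSR := (h.le_preRel Θ).trans hle
    have hRN : R ≤ N := h.eq_adjoint ▸
      le_adjoint_of_semidefinite (h.eq_adjoint ▸ h.le) hσ hR hSR
    obtain ⟨Θ', rfl⟩ := h.exists_preRel_eq hSR hRN
    rw [hmax Θ' ((h.semidefinite_iff σ Θ').1 hR) (h.preRel_le_iff.1 hle)]

/-- By the open mapping theorem `Υ` is a quotient map, and `N` is closed in `H × H`. -/
theorem isClosed_iff [CompleteSpace H] [CompleteSpace G] (hN : IsClosed (N : Set (H × H)))
    (Θ : Submodule ℂ (G × G)) :
    IsClosed (preRel Υ Θ : Set (H × H)) ↔ IsClosed (Θ : Set (G × G)) := by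
  have : CompleteSpace N := hN.completeSpace_coe
  rw [← (Υ.isQuotientMap h.surjective).isClosed_preimage,
    hN.isClosedEmbedding_subtypeVal.isClosed_iff_image_isClosed]
  rfl

/-- A boundary map preserves and reflects all kinds of relations. -/
theorem holds_iff [CompleteSpace H] [CompleteSpace G] (hN : IsClosed (N : Set (H × H)))
    (k : RelKind) (Θ : Submodule ℂ (G × G)) : k.Holds (preRel Υ Θ) ↔ k.Holds Θ := by
  cases k with
  | closed => exact h.isClosed_iff hN Θ
  | symmetric =>
    simp only [RelKind.Holds, RelSymmetric, h.preRel_adjoint, h.preRel_le_iff]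
  | selfAdjoint =>
    simp only [RelKind.Holds, RelSelfAdjoint, h.preRel_adjoint, h.preRel_injective.eq_iff]
  | dissipative =>
    simpa [RelKind.Holds, RelDissipative] using h.semidefinite_iff 1 Θ
  | maxDissipative =>
    simpa [RelKind.Holds, RelMaxDissipative, RelDissipative] using
      h.maximal_semidefinite_iff one_ne_zero Θ
  | accumulative =>
    simpa [RelKind.Holds, RelAccumulative] using h.semidefinite_iff (-1) Θ
  | maxAccumulative =>
    simpa [RelKind.Holds, RelMaxAccumulative, RelAccumulative] using
      h.maximal_semidefinite_iff (neg_ne_zero.2 one_ne_zero) Θ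

end IsBoundaryMap

end Transfer

/-! ### Graph-norm continuity and kernels of the extended boundary maps. -/

section Triple

variable {H : Type*} [NormedAddCommGroup H] [InnerProductSpace ℂ H]
  {G : Type*} [NormedAddCommGroup G] [InnerProductSpace ℂ G]
  {X : Type*} [NormedAddCommGroup X] [NormedSpace ℂ X]

theorem mem_graph_domRestrict {E F : Type*} [AddCommGroup E] [Module ℂ E] [AddCommGroup F]
    [Module ℂ F] {T : E →ₗ.[ℂ] F} {S : Submodule ℂ E} {p : E × F} :
    p ∈ (T.domRestrict S).graph ↔ p ∈ T.graph ∧ p.1 ∈ S := by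
  constructor
  · intro hp
    refine ⟨LinearPMap.le_graph_of_le LinearPMap.domRestrict_le hp, ?_⟩
    exact (LinearPMap.mem_domain_of_mem_graph (x := p.1) (y := p.2) hp).1
  · rintro ⟨hp, hS⟩
    obtain ⟨y, hy1, hy2⟩ := (LinearPMap.mem_graph_iff _).1 hp
    refine (LinearPMap.mem_graph_iff _).2 ⟨⟨p.1, hS, hy1 ▸ y.2⟩, rfl, ?_⟩
    rw [← hy2]
    exact LinearPMap.domRestrict_apply hy1.symm

theorem mem_graph_restrictKer {T : H →ₗ.[ℂ] H} {Γ : T.domain →ₗ[ℂ] G} {p : H × H} :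
    p ∈ (restrictKer T Γ).graph ↔ ∃ f : T.domain, Γ f = 0 ∧ ((f : H), T f) = p := by
  rw [restrictKer, mem_graph_domRestrict]
  constructor
  · rintro ⟨hp, f, hf, hfp⟩
    obtain ⟨y, hy1, hy2⟩ := (LinearPMap.mem_graph_iff _).1 hp
    have : y = f := Subtype.ext (hy1.trans hfp.symm)
    subst this
    exact ⟨y, hf, Prod.ext hy1 hy2⟩
  · rintro ⟨f, hf, rfl⟩
    exact ⟨T.mem_graph f, f, hf, rfl⟩

theorem toAntidual_apply (j : X →L[ℂ] G) (x : G) (y : X) :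
    toAntidual j x y = inner ℂ (j y) x := rfl

theorem toAntidual_injective {j : X →L[ℂ] G} (hj : DenseRange j) :
    Function.Injective (toAntidual j) := fun x y h => by
  exact hj.eq_of_inner_right ℂ fun v => DFunLike.congr_fun h v

/-- The map `f ↦ Γ' f` from the domain of the restriction of `T` to `ker Γ`, with the graph norm,
to the space `X` is continuous and surjective. -/
theorem IsAdmissible.exists_graphMap {T : H →ₗ.[ℂ] H} {Γ Γ' : T.domain →ₗ[ℂ] G} {j : X →L[ℂ] G}
    (hj : IsAdmissible Γ Γ' j) : ∃ κ : (restrictKer T Γ).graph →L[ℂ] X,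
      Function.Surjective κ ∧ ∀ (f : T.domain) (g : (restrictKer T Γ).graph), Γ f = 0 →
        (g : H × H) = ((f : H), T f) → j (κ g) = Γ' f := by
  obtain ⟨z, -, K, hK⟩ := hj.continuous_resolvent
  set κ : (restrictKer T Γ).graph →L[ℂ] X := K.comp
    ((ContinuousLinearMap.snd ℂ H H - conj z • ContinuousLinearMap.fst ℂ H H).comp
      (restrictKer T Γ).graph.subtypeL)
  have hκ : ∀ (f : T.domain) (g : (restrictKer T Γ).graph), Γ f = 0 →
      (g : H × H) = ((f : H), T f) → j (κ g) = Γ' f := by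
    intro f g hf hg
    rw [← hK f hf]
    simp [κ, hg]
  refine ⟨κ, fun x => ?_, hκ⟩
  obtain ⟨f, hf, hfx⟩ : j x ∈ (LinearMap.ker Γ).map Γ' := hj.range_eq ▸ ⟨x, rfl⟩
  refine ⟨⟨((f : H), T f), mem_graph_restrictKer.2 ⟨f, hf, rfl⟩⟩, hj.injective ?_⟩
  rw [hκ f _ hf rfl, hfx]

theorem IsAdmissible.denseRange {T : H →ₗ.[ℂ] H} {Γ Γ' : T.domain →ₗ[ℂ] G} {j : X →L[ℂ] G}
    (hj : IsAdmissible Γ Γ' j)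
    (hd : Dense (((LinearMap.ker Γ).map Γ' : Submodule ℂ G) : Set G)) : DenseRange j := by
  rw [← hj.range_eq] at hd
  exact hd

/-- Green's identity yields the continuity of a boundary map with respect to the graph norm. -/
theorem IsAdmissible.exists_norm_toAntidual_le [CompleteSpace H] [CompleteSpace X]
    {T : H →ₗ.[ℂ] H} {Γ Γ' : T.domain →ₗ[ℂ] G} {j : X →L[ℂ] G} (hj : IsAdmissible Γ Γ' j)
    (hsa : IsSelfAdjoint (restrictKer T Γ)) {ε : ℂ} (hε : ‖ε‖ = 1)
    (green : ∀ f g : T.domain, Γ g = 0 →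
      inner ℂ (Γ' g) (Γ f) = ε * (inner ℂ (T g) (f : H) - inner ℂ (g : H) (T f))) :
    ∃ C, ∀ f : T.domain, ‖toAntidual j (Γ f)‖ ≤ C * ‖((f : H), T f)‖ := by
  obtain ⟨κ, hsurj, hκ⟩ := hj.exists_graphMap
  -- Completeness of the graph gives, by the open mapping theorem, norm-controlled preimages under
  -- `κ`; Green's identity against such a preimage then bounds the functional on `X`.
  have : CompleteSpace (restrictKer T Γ).graph := hsa.isClosed.completeSpace_coe
  obtain ⟨C, hC, hpre⟩ := κ.exists_preimage_norm_le hsurj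
  refine ⟨2 * C, fun f => ContinuousLinearMap.opNorm_le_bound _ (by positivity) fun x => ?_⟩
  obtain ⟨p, rfl, hp⟩ := hpre x
  obtain ⟨g, hg, hgp⟩ := mem_graph_restrictKer.1 p.2
  rw [toAntidual_apply, hκ g p hg hgp.symm, green f g hg, norm_mul, hε, one_mul]
  have h1 : ‖(g : H)‖ ≤ ‖p‖ :=
    (congrArg (fun r : H × H => ‖r.1‖) hgp).trans_le (norm_fst_le (p : H × H))
  have h2 : ‖T g‖ ≤ ‖p‖ :=
    (congrArg (fun r : H × H => ‖r.2‖) hgp).trans_le (norm_snd_le (p : H × H))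
  have h3 : ‖(f : H)‖ ≤ ‖((f : H), T f)‖ := le_max_left _ _
  have h4 : ‖T f‖ ≤ ‖((f : H), T f)‖ := le_max_right _ _
  calc _ ≤ ‖inner ℂ (T g) (f : H)‖ + ‖inner ℂ (g : H) (T f)‖ := norm_sub_le _ _
    _ ≤ ‖T g‖ * ‖(f : H)‖ + ‖(g : H)‖ * ‖T f‖ :=
        add_le_add (norm_inner_le_norm _ _) (norm_inner_le_norm _ _)
    _ ≤ ‖p‖ * ‖((f : H), T f)‖ + ‖p‖ * ‖((f : H), T f)‖ := by gcongr
    _ ≤ (C * ‖κ p‖) * ‖((f : H), T f)‖ + (C * ‖κ p‖) * ‖((f : H), T f)‖ := by gcongr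
    _ = 2 * C * ‖((f : H), T f)‖ * ‖κ p‖ := by ring

/-- The map `h ↦ (R h, B R h)` where `R = (B - z)⁻¹`. -/
theorem exists_graph_resolvent {B : H →ₗ.[ℂ] H} {z : ℂ} (hz : z ∈ resolventSet B) :
    ∃ D : H →L[ℂ] B.graph, (∀ h, (D h : H × H).2 = h + z • (D h : H × H).1) ∧
      ∀ g : B.graph, D ((g : H × H).2 - z • (g : H × H).1) = g := by
  obtain ⟨R, hR, hR'⟩ := hz
  have hmem : ∀ h, (R.prod (ContinuousLinearMap.id ℂ H + z • R)) h ∈ B.graph := by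
    intro h
    obtain ⟨hd, e⟩ := hR h
    refine (LinearPMap.mem_graph_iff _).2 ⟨⟨R h, hd⟩, rfl, ?_⟩
    simpa using sub_eq_iff_eq_add.1 e
  refine ⟨(R.prod (ContinuousLinearMap.id ℂ H + z • R)).codRestrict B.graph hmem,
    fun h => rfl, fun g => ?_⟩
  obtain ⟨f, hf1, hf2⟩ := (LinearPMap.mem_graph_iff _).1 g.2
  have h1 : R ((g : H × H).2 - z • (g : H × H).1) = (g : H × H).1 := by
    rw [← hf1, ← hf2]; exact hR' f
  refine Subtype.ext (Prod.ext h1 ?_)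
  change (g : H × H).2 - z • (g : H × H).1 + z • R _ = _
  rw [h1, sub_add_cancel]

theorem graph_eq_adjoint_of_isSelfAdjoint [CompleteSpace H] {B : H →ₗ.[ℂ] H}
    (hB : IsSelfAdjoint B) : B.graph = B.graph.adjoint := by
  rw [← LinearPMap.adjoint_graph_eq_graph_adjoint hB.dense_domain,
    LinearPMap.isSelfAdjoint_def.1 hB]

namespace QuasiBoundaryTriple

variable [CompleteSpace H] {A T : H →ₗ.[ℂ] H} (q : QuasiBoundaryTriple A T G)
include q

theorem denseRange_incl (hA : Dense (A.domain : Set H)) : DenseRange q.incl := by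
  have hcl : T.IsClosable :=
    (LinearPMap.adjoint_isClosed hA).isClosable.leIsClosable q.le_adjoint
  have h := hcl.graph_closure_eq_closure_graph
  rw [q.closure_eq] at h
  rw [DenseRange, Subtype.dense_iff]
  intro p hp
  rw [SetLike.mem_coe, ← h] at hp
  refine closure_mono ?_ hp
  intro r hr
  obtain ⟨f, h1, h2⟩ := (LinearPMap.mem_graph_iff _).1 hr
  exact ⟨q.incl f, ⟨f, rfl⟩, Prod.ext h1 h2⟩

theorem extendBoundaryMap_incl (hA : Dense (A.domain : Set H)) (Γ : T.domain →ₗ[ℂ] G)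
    (j : X →L[ℂ] G)
    (hC : ∃ C, ∀ f : T.domain, ‖toAntidual j (Γ f)‖ ≤ C * ‖((f : H), T f)‖) (f : T.domain) :
    q.extendBoundaryMap Γ j (q.incl f) = toAntidual j (Γ f) :=
  LinearMap.extendOfNorm_eq (q.denseRange_incl hA) hC f

theorem extΓ₀_incl [CompleteSpace X] (hA : Dense (A.domain : Set H)) {j : X →L[ℂ] G}
    (hj : IsAdmissible q.Γ₀ q.Γ₁ j) (f : T.domain) :
    q.extΓ₀ j (q.incl f) = toAntidual j (q.Γ₀ f) := by
  refine q.extendBoundaryMap_incl hA _ j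
    (hj.exists_norm_toAntidual_le q.selfAdjoint (ε := 1) (by simp) fun f g hg => ?_) f
  have := q.green f g
  rw [hg, inner_zero_left] at this
  linear_combination this

theorem extΓ₁_incl [CompleteSpace X] (hA : Dense (A.domain : Set H)) {j : X →L[ℂ] G}
    (hj : IsAdmissible q.Γ₁ q.Γ₀ j) (hA₁ : IsSelfAdjoint (restrictKer T q.Γ₁)) (f : T.domain) :
    q.extΓ₁ j (q.incl f) = toAntidual j (q.Γ₁ f) := by
  -- Exchanging `Γ₀` and `Γ₁` reverses the sign in Green's identity, hence `ε = -1`.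
  refine q.extendBoundaryMap_incl hA _ j
    (hj.exists_norm_toAntidual_le hA₁ (ε := -1) (by simp) fun f g hg => ?_) f
  have := q.green f g
  rw [hg, inner_zero_left] at this
  linear_combination -this

theorem graph_restrictKer_le (Γ : T.domain →ₗ[ℂ] G) :
    (restrictKer T Γ).graph ≤ A.adjoint.graph :=
  LinearPMap.le_graph_of_le (LinearPMap.domRestrict_le.trans q.le_adjoint)

/-- Green's identity for the extended boundary map `Γ̃₀`. -/
theorem extΓ₀_apply [CompleteSpace X] (hA : Dense (A.domain : Set H)) {j : X →L[ℂ] G}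
    (hj : IsAdmissible q.Γ₀ q.Γ₁ j) {κ : (restrictKer T q.Γ₀).graph →L[ℂ] X}
    (hκ : ∀ (f : T.domain) (g : (restrictKer T q.Γ₀).graph), q.Γ₀ f = 0 →
        (g : H × H) = ((f : H), T f) → j (κ g) = q.Γ₁ f)
    (p : A.adjoint.graph) (g : (restrictKer T q.Γ₀).graph) :
    q.extΓ₀ j p (κ g) =
      inner ℂ (g : H × H).2 (p : H × H).1 - inner ℂ (g : H × H).1 (p : H × H).2 := by
  refine (q.denseRange_incl hA).induction_on p (isClosed_eq (by fun_prop) (by fun_prop))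
    fun f => ?_
  obtain ⟨g', hg', e⟩ := mem_graph_restrictKer.1 g.2
  rw [q.extΓ₀_incl hA hj, toAntidual_apply, hκ g' g hg' e.symm, ← e]
  have := q.green f g'
  rw [hg', inner_zero_left] at this
  change _ = inner ℂ (T g') (f : H) - inner ℂ (g' : H) (T f)
  linear_combination this

/-- As `κ` is onto, `Γ̃₀ p = 0` says that the Green form of `p` against all of `A₀` vanishes, that
is, `p ∈ A₀* = A₀`. -/
theorem extΓ₀_eq_zero_iff [CompleteSpace X] (hA : Dense (A.domain : Set H)) {j : X →L[ℂ] G}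
    (hj : IsAdmissible q.Γ₀ q.Γ₁ j) (p : A.adjoint.graph) :
    q.extΓ₀ j p = 0 ↔ (p : H × H) ∈ (restrictKer T q.Γ₀).graph := by
  obtain ⟨κ, hsurj, hκ⟩ := hj.exists_graphMap
  have hadj := graph_eq_adjoint_of_isSelfAdjoint q.selfAdjoint
  constructor
  · intro h0
    rw [hadj, Submodule.mem_adjoint_iff]
    intro a b hab
    rw [← q.extΓ₀_apply hA hj hκ p ⟨(a, b), hab⟩, h0]
    rfl
  · intro hp
    rw [hadj, Submodule.mem_adjoint_iff] at hp
    ext x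
    obtain ⟨g, rfl⟩ := hsurj x
    rw [q.extΓ₀_apply hA hj hκ]
    exact hp _ _ g.2

/-- The minimal operator is contained in the restriction of `T` to `ker Γ₀`. -/
theorem le_restrictKer (hA : Dense (A.domain : Set H)) :
    A.graph ≤ (restrictKer T q.Γ₀).graph := by
  rw [graph_eq_adjoint_of_isSelfAdjoint q.selfAdjoint]
  intro p hp
  rw [Submodule.mem_adjoint_iff]
  intro a b hab
  have h1 := q.graph_restrictKer_le _ hab
  rw [LinearPMap.adjoint_graph_eq_graph_adjoint hA, Submodule.mem_adjoint_iff] at h1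
  have h2 := congrArg conj (h1 p.1 p.2 hp)
  simp only [map_sub, inner_conj_symm, map_zero] at h2
  linear_combination -h2

/-- `Γ₁` vanishes on the domain of the minimal operator. -/
theorem Γ₁_eq_zero (hA : Dense (A.domain : Set H))
    (hd : Dense (((LinearMap.ker q.Γ₁).map q.Γ₀ : Submodule ℂ G) : Set G)) (f : T.domain)
    (hf : ((f : H), T f) ∈ A.graph) (hf₀ : q.Γ₀ f = 0) : q.Γ₁ f = 0 := by
  refine hd.eq_zero_of_inner_right ℂ ?_
  rintro _ ⟨g, -, rfl⟩
  have h1 := LinearPMap.le_graph_of_le q.le_adjoint (T.mem_graph g)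
  rw [LinearPMap.adjoint_graph_eq_graph_adjoint hA, Submodule.mem_adjoint_iff] at h1
  have h2 := congrArg conj (h1 _ _ hf)
  simp only [map_sub, inner_conj_symm, map_zero] at h2
  have h3 := q.green f g
  rw [hf₀, inner_zero_right] at h3
  linear_combination h2 - h3

end QuasiBoundaryTriple

end Triple

/-! ### The regularized ordinary boundary triple and the parameter `ϑ`. -/

section OrdinaryTriple

variable {H G X₀ X₁ : Type*} [NormedAddCommGroup H] [InnerProductSpace ℂ H] [CompleteSpace H]
  [NormedAddCommGroup G] [InnerProductSpace ℂ G]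
  [NormedAddCommGroup X₀] [NormedSpace ℂ X₀] [CompleteSpace X₀]
  [NormedAddCommGroup X₁] [NormedSpace ℂ X₁] [CompleteSpace X₁]
  {A T : H →ₗ.[ℂ] H}

namespace QuasiBoundaryTriple

variable (q : QuasiBoundaryTriple A T G)

/-- The ordinary boundary map `f ↦ (ι₋ Γ̃₀ f, ι₊ κ D (A* - z) f)` on `dom A*`. -/
noncomputable def ordinaryMap (j₁ : X₁ →L[ℂ] G) (ιp : X₁ ≃L[ℂ] G)
    (ιm : (X₁ →L⋆[ℂ] ℂ) ≃L[ℂ] G) (z : ℂ) (κ : (restrictKer T q.Γ₀).graph →L[ℂ] X₁)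
    (D : H →L[ℂ] (restrictKer T q.Γ₀).graph) : A.adjoint.graph →L[ℂ] G × G :=
  ((ιm : (X₁ →L⋆[ℂ] ℂ) →L[ℂ] G).comp (q.extΓ₀ j₁)).prod
    (((ιp : X₁ →L[ℂ] G).comp (κ.comp D)).comp
      ((ContinuousLinearMap.snd ℂ H H - z • ContinuousLinearMap.fst ℂ H H).comp
        A.adjoint.graph.subtypeL))

/-- Every element of the antidual is a boundary value `Γ̃₀ f` with `f ∈ ker (A* - z)`, `z` real. -/
theorem exists_extΓ₀_eq (hA : Dense (A.domain : Set H))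
    (hd : Dense (((LinearMap.ker q.Γ₁).map q.Γ₀ : Submodule ℂ G) : Set G))
    {j₁ : X₁ →L[ℂ] G} (hj₁ : IsAdmissible q.Γ₀ q.Γ₁ j₁) {η : ℝ}
    (hη : (η : ℂ) ∈ resolventSet (restrictKer T q.Γ₀)) (x' : X₁ →L⋆[ℂ] ℂ) :
    ∃ p : A.adjoint.graph, (p : H × H).2 = (η : ℂ) • (p : H × H).1 ∧ q.extΓ₀ j₁ p = x' := by
  obtain ⟨κ, hsurj, hκ⟩ := hj₁.exists_graphMap
  obtain ⟨D, -, hD⟩ := exists_graph_resolvent hη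
  -- Conjugating the antilinear functional `x' ∘ Γ₁ (A₀ - η)⁻¹` makes it linear; its Riesz vector
  -- `u` is the desired element of `ker (A* - η)`.
  set φ : StrongDual ℂ H := ((starₗᵢ ℂ : ℂ ≃ₗᵢ⋆[ℂ] ℂ) : ℂ →L⋆[ℂ] ℂ).comp (x'.comp (κ.comp D))
    with hφ
  set u := (InnerProductSpace.toDual ℂ H).symm φ with hu
  have hin : ∀ h, inner ℂ h u = x' (κ (D h)) := by
    intro h
    rw [← inner_conj_symm, hu, InnerProductSpace.toDual_symm_apply]
    exact Complex.conj_conj _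
  have hin' : ∀ a b, inner ℂ b u - inner ℂ a ((η : ℂ) • u) = x' (κ (D (b - (η : ℂ) • a))) := by
    intro a b
    rw [← hin, inner_sub_left, inner_smul_left, inner_smul_right, Complex.conj_ofReal]
  have hu : (u, (η : ℂ) • u) ∈ A.adjoint.graph := by
    rw [LinearPMap.adjoint_graph_eq_graph_adjoint hA, Submodule.mem_adjoint_iff]
    intro a b hab
    have hab₀ := q.le_restrictKer hA hab
    obtain ⟨f, hf, e⟩ := mem_graph_restrictKer.1 hab₀
    -- The functional kills `ran (A - η)` because `Γ₁` vanishes on `dom A`; hence `u` is orthogonal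
    -- to that range.
    have h0 : κ ⟨(a, b), hab₀⟩ = 0 := by
      refine hj₁.injective ?_
      rw [hκ f _ hf e.symm, map_zero, q.Γ₁_eq_zero hA hd f (e ▸ hab) hf]
    rw [hin', hD ⟨(a, b), hab₀⟩, h0, map_zero]
  refine ⟨⟨_, hu⟩, rfl, ?_⟩
  ext x
  obtain ⟨g, rfl⟩ := hsurj x
  rw [q.extΓ₀_apply hA hj₁ hκ]
  exact (hin' _ _).trans (by rw [hD])

theorem isBoundaryMap_ordinaryMap (hA_closed : A.IsClosed) (hA : Dense (A.domain : Set H))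
    (hA_symm : A ≤ A.adjoint)
    (hd : Dense (((LinearMap.ker q.Γ₁).map q.Γ₀ : Submodule ℂ G) : Set G))
    {j₁ : X₁ →L[ℂ] G} (hj₁ : IsAdmissible q.Γ₀ q.Γ₁ j₁) {η : ℝ}
    (hη : (η : ℂ) ∈ resolventSet (restrictKer T q.Γ₀)) {ιp : X₁ ≃L[ℂ] G}
    {ιm : (X₁ →L⋆[ℂ] ℂ) ≃L[ℂ] G}
    (hι : ∀ (x : X₁) (x' : X₁ →L⋆[ℂ] ℂ), inner ℂ (ιp x) (ιm x') = x' x)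
    {κ : (restrictKer T q.Γ₀).graph →L[ℂ] X₁} (hsurj : Function.Surjective κ)
    (hκ : ∀ (f : T.domain) (g : (restrictKer T q.Γ₀).graph), q.Γ₀ f = 0 →
        (g : H × H) = ((f : H), T f) → j₁ (κ g) = q.Γ₁ f)
    {D : H →L[ℂ] (restrictKer T q.Γ₀).graph}
    (hD : ∀ h, (D h : H × H).2 = h + (η : ℂ) • (D h : H × H).1)
    (hD' : ∀ g : (restrictKer T q.Γ₀).graph,
      D ((g : H × H).2 - (η : ℂ) • (g : H × H).1) = g) :
    IsBoundaryMap A.graph A.adjoint.graph (q.ordinaryMap j₁ ιp ιm η κ D) := by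
  have hΥ : ∀ p : A.adjoint.graph, q.ordinaryMap j₁ ιp ιm η κ D p =
      (ιm (q.extΓ₀ j₁ p), ιp (κ (D ((p : H × H).2 - (η : ℂ) • (p : H × H).1)))) := fun _ => rfl
  have hN := LinearPMap.adjoint_graph_eq_graph_adjoint hA
  have hle := LinearPMap.le_graph_of_le hA_symm
  have hsa : ∀ g g' : (restrictKer T q.Γ₀).graph, inner ℂ (g : H × H).2 (g' : H × H).1 -
      inner ℂ (g : H × H).1 (g' : H × H).2 = 0 := by
    intro g g'
    have h := (graph_eq_adjoint_of_isSelfAdjoint q.selfAdjoint).le g'.2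
    exact (Submodule.mem_adjoint_iff _ _).1 h _ _ g.2
  have hgreen : ∀ f g : A.adjoint.graph,
      inner ℂ (g : H × H).1 (f : H × H).2 - inner ℂ (g : H × H).2 (f : H × H).1 =
      inner ℂ (q.ordinaryMap j₁ ιp ιm η κ D g).1 (q.ordinaryMap j₁ ιp ιm η κ D f).2 -
      inner ℂ (q.ordinaryMap j₁ ιp ιm η κ D g).2 (q.ordinaryMap j₁ ιp ιm η κ D f).1 := by
    intro f g
    simp only [hΥ]
    rw [← inner_conj_symm (ιm _), hι, hι, q.extΓ₀_apply hA hj₁ hκ, q.extΓ₀_apply hA hj₁ hκ,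
      map_sub, inner_conj_symm, inner_conj_symm]
    set h := (f : H × H).2 - (η : ℂ) • (f : H × H).1 with hh
    set k := (g : H × H).2 - (η : ℂ) • (g : H × H).1 with hk
    have ef : (f : H × H).2 = h + (η : ℂ) • (f : H × H).1 := by rw [hh, sub_add_cancel]
    have eg : (g : H × H).2 = k + (η : ℂ) • (g : H × H).1 := by rw [hk, sub_add_cancel]
    -- After substituting `A* = h + η` on both sides, with `η` real, Green's identity reduces to the
    -- symmetry of `(A₀ - η)⁻¹`.
    have h0 := hsa (D k) (D h)
    rw [hD, hD] at h0
    rw [ef, eg, hD, hD]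
    simp only [inner_add_left, inner_add_right, inner_smul_left, inner_smul_right,
      Complex.conj_ofReal] at h0 ⊢
    linear_combination h0
  have hsurjΥ : Function.Surjective (q.ordinaryMap j₁ ιp ιm η κ D) := by
    rintro ⟨a, b⟩
    -- The two components are prescribed independently: the second vanishes on `ker (A* - η)` and
    -- the first on `dom A₀`.
    obtain ⟨p, hp, hpa⟩ := q.exists_extΓ₀_eq hA hd hj₁ hη (ιm.symm a)
    obtain ⟨g, hg⟩ := hsurj (ιp.symm b)
    refine ⟨p + ⟨g, q.graph_restrictKer_le _ g.2⟩, ?_⟩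
    rw [map_add, hΥ, hΥ, hpa, hp, (q.extΓ₀_eq_zero_iff hA hj₁ _).2 g.2, hD' g, hg,
      sub_self]
    simp
  refine ⟨hN, hle, hsurjΥ, fun p => ⟨fun h0 => ?_, fun hp => ?_⟩, hgreen⟩
  -- If `Υ p = 0`, Green's identity puts `p` in `A** = A`.
  · refine adjoint_adjoint_le _ hA_closed ?_
    rw [Submodule.mem_adjoint_iff, ← hN]
    intro a b hab
    have := hgreen p ⟨(a, b), hab⟩
    rw [h0] at this
    simp only [Prod.fst_zero, Prod.snd_zero, inner_zero_right] at this
    linear_combination -this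
  · have hp₀ := q.le_restrictKer hA hp
    obtain ⟨f, hf, e⟩ := mem_graph_restrictKer.1 hp₀
    have h0 : κ ⟨p, hp₀⟩ = 0 := by
      refine hj₁.injective ?_
      rw [hκ f _ hf e.symm, map_zero, q.Γ₁_eq_zero hA hd f (e ▸ hp) hf]
    rw [hΥ, (q.extΓ₀_eq_zero_iff hA hj₁ p).2 hp₀, hD' ⟨p, hp₀⟩, h0]
    simp

omit [CompleteSpace X₀] [CompleteSpace X₁] in
theorem mem_extWeyl {j₀ : X₀ →L[ℂ] G} {j₁ : X₁ →L[ℂ] G} {z : ℂ}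
    {x : (X₁ →L⋆[ℂ] ℂ) × (X₀ →L⋆[ℂ] ℂ)} : x ∈ q.extWeyl j₀ j₁ z ↔
      ∃ p : A.adjoint.graph, (p : H × H).2 = z • (p : H × H).1 ∧
        q.extΓ₀ j₁ p = x.1 ∧ q.extΓ₁ j₀ p = x.2 := by
  simp only [extWeyl, Submodule.mem_map, LinearMap.mem_ker]
  refine exists_congr fun p => and_congr ?_ Prod.ext_iff
  exact sub_eq_zero

/-- Elements of `ker (A* - z)` are determined by their boundary value `Γ̃₀ f`. -/
theorem eq_of_extΓ₀_eq (hA : Dense (A.domain : Set H)) {j₁ : X₁ →L[ℂ] G}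
    (hj₁ : IsAdmissible q.Γ₀ q.Γ₁ j₁) {z : ℂ} (hz : z ∈ resolventSet (restrictKer T q.Γ₀))
    {p p' : A.adjoint.graph} (hp : (p : H × H).2 = z • (p : H × H).1)
    (hp' : (p' : H × H).2 = z • (p' : H × H).1) (h : q.extΓ₀ j₁ p = q.extΓ₀ j₁ p') : p = p' := by
  obtain ⟨D, -, hD⟩ := exists_graph_resolvent hz
  -- The difference lies in `ker (A₀ - z)`, which is trivial since `z` is in the resolvent set.
  have hm := (q.extΓ₀_eq_zero_iff hA hj₁ (p - p')).1 (by rw [map_sub, h, sub_self])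
  have h1 := hD ⟨_, hm⟩
  have h2 : ((p - p' : A.adjoint.graph) : H × H).2 - z • ((p - p' : A.adjoint.graph) : H × H).1
      = 0 := by
    simp [hp, hp', smul_sub]
  rw [h2, map_zero] at h1
  exact sub_eq_zero.1 (Subtype.ext (congrArg Subtype.val h1).symm)

theorem extΓ_mem_param_iff (hA : Dense (A.domain : Set H))
    (hA₁ : IsSelfAdjoint (restrictKer T q.Γ₁))
    (hd : Dense (((LinearMap.ker q.Γ₁).map q.Γ₀ : Submodule ℂ G) : Set G))
    {j₀ : X₀ →L[ℂ] G} (hj₀ : IsAdmissible q.Γ₁ q.Γ₀ j₀)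
    {j₁ : X₁ →L[ℂ] G} (hj₁ : IsAdmissible q.Γ₀ q.Γ₁ j₁) {η : ℝ}
    (hη : (η : ℂ) ∈ resolventSet (restrictKer T q.Γ₀)) {ιp : X₁ ≃L[ℂ] G}
    {ιm : (X₁ →L⋆[ℂ] ℂ) ≃L[ℂ] G} {κ : (restrictKer T q.Γ₀).graph →L[ℂ] X₁}
    (hκ : ∀ (f : T.domain) (g : (restrictKer T q.Γ₀).graph), q.Γ₀ f = 0 →
        (g : H × H) = ((f : H), T f) → j₁ (κ g) = q.Γ₁ f)
    {D : H →L[ℂ] (restrictKer T q.Γ₀).graph}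
    (hD' : ∀ g : (restrictKer T q.Γ₀).graph,
      D ((g : H × H).2 - (η : ℂ) • (g : H × H).1) = g)
    (Θ : Submodule ℂ (G × G)) (p : A.adjoint.graph) :
    q.extΓ j₀ j₁ p ∈ q.param j₀ j₁ ιp ιm η Θ ↔ q.ordinaryMap j₁ ιp ιm η κ D p ∈ Θ := by
  -- Here `r` is the part `f_η` of `p`. Since `p - r ∈ dom A₀ ⊆ dom T`, the map `Γ̃₁` acts on it as
  -- `Γ₁`, which `κ D (A* - η)` computes.
  have key : ∀ r : A.adjoint.graph, (r : H × H).2 = (η : ℂ) • (r : H × H).1 →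
      q.extΓ₀ j₁ r = q.extΓ₀ j₁ p → q.extΓ₁ j₀ p = toAntidual j₀
        (j₁ (κ (D ((p : H × H).2 - (η : ℂ) • (p : H × H).1)))) + q.extΓ₁ j₀ r := by
    intro r hr hrp
    have hm := (q.extΓ₀_eq_zero_iff hA hj₁ (p - r)).1 (by rw [map_sub, hrp, sub_self])
    have h1 := hD' ⟨_, hm⟩
    have h2 : ((p - r : A.adjoint.graph) : H × H).2 -
        (η : ℂ) • ((p - r : A.adjoint.graph) : H × H).1 =
        (p : H × H).2 - (η : ℂ) • (p : H × H).1 := by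
      simp [hr, smul_sub]
    rw [h2] at h1
    obtain ⟨f, hf, e⟩ := mem_graph_restrictKer.1 hm
    rw [h1, hκ f _ hf e.symm, ← q.extΓ₁_incl hA hj₀ hA₁, ← map_add]
    congr 1
    rw [show q.incl f = p - r from Subtype.ext e, sub_add_cancel]
  constructor
  · rintro ⟨y, z, ⟨w, hw, hy⟩, hz, hyz⟩
    obtain ⟨r, hr, hr0, hr1⟩ := q.mem_extWeyl.1 hz
    have h1 := key r hr hr0
    have hyz' : q.extΓ₁ j₀ p = y + z := hyz
    rw [hyz', hr1] at h1
    have h2 : toAntidual j₀ (j₁ (ιp.symm w)) = _ := hy.symm.trans (add_right_cancel h1)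
    -- The equality holds in `X₀'`; it descends to `X₁` because both `X₁ → G` and `G → X₀'` are
    -- injective, the latter by density of `X₀` in `G`.
    have h3 := hj₁.injective (toAntidual_injective (hj₀.denseRange hd) h2)
    rw [ContinuousLinearEquiv.symm_apply_eq] at h3
    rw [h3] at hw
    exact hw
  · intro hp
    obtain ⟨r, hr, hr0⟩ := q.exists_extΓ₀_eq hA hd hj₁ hη (q.extΓ₀ j₁ p)
    refine ⟨_, _, ⟨_, hp, rfl⟩, q.mem_extWeyl.2 ⟨r, hr, hr0, rfl⟩, ?_⟩
    refine (key r hr hr0).trans ?_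
    change _ = toAntidual j₀ (j₁ (ιp.symm (ιp _))) + _
    rw [ιp.symm_apply_apply]
    rfl

omit [CompleteSpace X₀] [CompleteSpace X₁] in
theorem graph_extension {j₀ : X₀ →L[ℂ] G} {j₁ : X₁ →L[ℂ] G}
    {ϑ : Submodule ℂ ((X₁ →L⋆[ℂ] ℂ) × (X₀ →L⋆[ℂ] ℂ))} {p : H × H} :
    p ∈ (q.extension j₀ j₁ ϑ).graph ↔ ∃ h : p ∈ A.adjoint.graph, q.extΓ j₀ j₁ ⟨p, h⟩ ∈ ϑ := by
  rw [extension, mem_graph_domRestrict]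
  constructor
  · rintro ⟨hp, r, hr, e⟩
    have : r = ⟨p, hp⟩ := Subtype.ext (LinearPMap.mem_graph_snd_inj' _ r.2 hp e |> Prod.ext e)
    exact ⟨hp, this ▸ hr⟩
  · rintro ⟨hp, h⟩
    exact ⟨hp, ⟨p, hp⟩, h, rfl⟩

end QuasiBoundaryTriple

end OrdinaryTriple

end BoundaryTriple

/-! ### The correspondence and the regularity statement. -/

theorem mainTheorem4
    {H G X₀ X₁ : Type*}
    [NormedAddCommGroup H] [InnerProductSpace ℂ H] [CompleteSpace H]
    [NormedAddCommGroup G] [InnerProductSpace ℂ G] [CompleteSpace G]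
    [NormedAddCommGroup X₀] [NormedSpace ℂ X₀] [CompleteSpace X₀]
    [NormedAddCommGroup X₁] [NormedSpace ℂ X₁] [CompleteSpace X₁]
    -- a closed, densely defined, symmetric operator `A`
    (A T : H →ₗ.[ℂ] H) (hA_closed : A.IsClosed) (hA_dense : Dense (A.domain : Set H))
    (hA_symm : A ≤ A.adjoint)
    -- a quasi boundary triple for `T ⊆ A*` with self-adjoint `A₁`
    (q : BoundaryTriple.QuasiBoundaryTriple A T G)
    (hA₁ : IsSelfAdjoint (BoundaryTriple.restrictKer T q.Γ₁))
    (η : ℝ)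
    (hη₀ : (η : ℂ) ∈ BoundaryTriple.resolventSet (BoundaryTriple.restrictKer T q.Γ₀))
    (hη₁ : (η : ℂ) ∈ BoundaryTriple.resolventSet (BoundaryTriple.restrictKer T q.Γ₁))
    -- the spaces `ran (Γ₀ ↾ ker Γ₁)` and `ran (Γ₁ ↾ ker Γ₀)` are dense
    (hdense₀ : Dense (((LinearMap.ker q.Γ₁).map q.Γ₀ : Submodule ℂ G) : Set G))
    (hdense₁ : Dense (((LinearMap.ker q.Γ₀).map q.Γ₁ : Submodule ℂ G) : Set G))
    -- these spaces with admissible norms, as Banach spaces `X₀`, `X₁` embedded in `G`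
    (j₀ : X₀ →L[ℂ] G) (hj₀ : BoundaryTriple.IsAdmissible q.Γ₁ q.Γ₀ j₀)
    (j₁ : X₁ →L[ℂ] G) (hj₁ : BoundaryTriple.IsAdmissible q.Γ₀ q.Γ₁ j₁)
    -- isomorphisms with `(ι₋ x', ι₊ x) = ⟨x', x⟩`
    (ιp : X₁ ≃L[ℂ] G) (ιm : (X₁ →L⋆[ℂ] ℂ) ≃L[ℂ] G)
    (hι : ∀ (x : X₁) (x' : X₁ →L⋆[ℂ] ℂ), inner ℂ (ιp x) (ιm x') = x' x) :
    -- the extended maps are what they should be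
    ((∀ f : T.domain, q.extΓ j₀ j₁ (q.incl f) =
        (BoundaryTriple.toAntidual j₁ (q.Γ₀ f), BoundaryTriple.toAntidual j₀ (q.Γ₁ f))) ∧
      (∀ x, ∃! y, (x, y) ∈ q.extWeyl j₀ j₁ η)) ∧
    -- the bijective correspondence, for relations of each kind and for closed ones of each kind
    (∀ k : BoundaryTriple.RelKind,
      Set.BijOn (fun Θ => q.extension j₀ j₁ (q.param j₀ j₁ ιp ιm η Θ))
        {Θ : Submodule ℂ (G × G) | k.Holds Θ}
        {B : H →ₗ.[ℂ] H | A ≤ B ∧ B ≤ A.adjoint ∧ k.Holds B.graph} ∧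
      Set.BijOn (fun Θ => q.extension j₀ j₁ (q.param j₀ j₁ ιp ιm η Θ))
        {Θ : Submodule ℂ (G × G) | IsClosed (Θ : Set (G × G)) ∧ k.Holds Θ}
        {B : H →ₗ.[ℂ] H | A ≤ B ∧ B ≤ A.adjoint ∧ B.IsClosed ∧ k.Holds B.graph}) ∧
    -- the regularity result
    (∀ (Θ : Submodule ℂ (G × G)) (S : H →ₗ.[ℂ] H), T ≤ S → S ≤ A.adjoint →
      (∀ x ∈ BoundaryTriple.relDom Θ, ∃ g : A.adjoint.graph,
        (g : H × H).1 ∈ S.domain ∧ ιm (q.extΓ₀ j₁ g) = x) →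
      (q.extension j₀ j₁ (q.param j₀ j₁ ιp ιm η Θ)).domain ≤ S.domain) := by
  obtain ⟨κ, hsurj, hκ⟩ := hj₁.exists_graphMap
  obtain ⟨D, hD, hD'⟩ := BoundaryTriple.exists_graph_resolvent hη₀
  have hb := q.isBoundaryMap_ordinaryMap hA_closed hA_dense hA_symm hdense₀ hj₁ hη₀ hι hsurj hκ
    hD hD'
  have hmem := q.extΓ_mem_param_iff (ιp := ιp) (ιm := ιm) hA_dense hA₁ hdense₀ hj₀ hj₁ hη₀ hκ hD'
  have hgraph : ∀ Θ, (q.extension j₀ j₁ (q.param j₀ j₁ ιp ιm η Θ)).graph =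
      BoundaryTriple.preRel (q.ordinaryMap j₁ ιp ιm η κ D) Θ := by
    intro Θ
    ext p
    rw [q.graph_extension, BoundaryTriple.mem_preRel]
    exact exists_congr fun h => hmem Θ ⟨p, h⟩
  have hholds : ∀ (k : BoundaryTriple.RelKind) Θ,
      k.Holds (q.extension j₀ j₁ (q.param j₀ j₁ ιp ιm η Θ)).graph ↔ k.Holds Θ := by
    intro k Θ
    rw [hgraph]
    exact hb.holds_iff (LinearPMap.adjoint_isClosed hA_dense) k Θ
  have hinj : Function.Injective fun Θ => q.extension j₀ j₁ (q.param j₀ j₁ ιp ιm η Θ) := by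
    intro Θ Θ' h
    refine hb.preRel_injective ?_
    rw [← hgraph, ← hgraph]
    exact congrArg LinearPMap.graph h
  have hle : ∀ Θ, A ≤ q.extension j₀ j₁ (q.param j₀ j₁ ιp ιm η Θ) ∧
      q.extension j₀ j₁ (q.param j₀ j₁ ιp ιm η Θ) ≤ A.adjoint := by
    intro Θ
    rw [← LinearPMap.le_graph_iff, ← LinearPMap.le_graph_iff, hgraph]
    exact ⟨hb.le_preRel Θ, BoundaryTriple.IsBoundaryMap.preRel_le Θ⟩
  have hex : ∀ B : H →ₗ.[ℂ] H, A ≤ B → B ≤ A.adjoint →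
      ∃ Θ, q.extension j₀ j₁ (q.param j₀ j₁ ιp ιm η Θ) = B := by
    intro B h1 h2
    obtain ⟨Θ, h⟩ := hb.exists_preRel_eq (LinearPMap.le_graph_of_le h1)
      (LinearPMap.le_graph_of_le h2)
    exact ⟨Θ, LinearPMap.eq_of_eq_graph ((hgraph Θ).trans h)⟩
  refine ⟨⟨fun f => ?_, fun x => ?_⟩, fun k => ⟨⟨?_, hinj.injOn, ?_⟩, ⟨?_, hinj.injOn, ?_⟩⟩, ?_⟩
  · exact Prod.ext (q.extΓ₀_incl hA_dense hj₁ f) (q.extΓ₁_incl hA_dense hj₀ hA₁ f)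
  · obtain ⟨p, hp, rfl⟩ := q.exists_extΓ₀_eq hA_dense hdense₀ hj₁ hη₀ x
    refine ⟨q.extΓ₁ j₀ p, q.mem_extWeyl.2 ⟨p, hp, rfl, rfl⟩, fun y hy => ?_⟩
    obtain ⟨p', hp', h0, rfl⟩ := q.mem_extWeyl.1 hy
    rw [q.eq_of_extΓ₀_eq hA_dense hj₁ hη₀ hp' hp h0]
  · exact fun Θ hΘ => ⟨(hle Θ).1, (hle Θ).2, (hholds k Θ).2 hΘ⟩
  · rintro B ⟨h1, h2, hB⟩
    obtain ⟨Θ, rfl⟩ := hex B h1 h2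
    exact ⟨Θ, (hholds k Θ).1 hB, rfl⟩
  · exact fun Θ hΘ => ⟨(hle Θ).1, (hle Θ).2, (hholds .closed Θ).2 hΘ.1, (hholds k Θ).2 hΘ.2⟩
  · rintro B ⟨h1, h2, hBc, hB⟩
    obtain ⟨Θ, rfl⟩ := hex B h1 h2
    exact ⟨Θ, ⟨(hholds .closed Θ).1 hBc, (hholds k Θ).1 hB⟩, rfl⟩
  · intro Θ S hTS hSA hΘ x hx
    obtain ⟨y, hxy⟩ := LinearPMap.mem_domain_iff.1 hx
    rw [hgraph] at hxy
    obtain ⟨hp, hpΘ⟩ := BoundaryTriple.mem_preRel.1 hxy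
    obtain ⟨g, hgS, hg⟩ := hΘ _ ⟨_, hpΘ, rfl⟩
    -- Equal values of `ι₋ Γ̃₀` place `x - g` in `dom A₀ ⊆ dom T ⊆ dom S`.
    have h0 : q.extΓ₀ j₁ (⟨(x, y), hp⟩ - g) = 0 := by
      rw [map_sub, sub_eq_zero]
      exact (ιm.injective hg).symm
    obtain ⟨f, -, e⟩ := BoundaryTriple.mem_graph_restrictKer.1
      ((q.extΓ₀_eq_zero_iff hA_dense hj₁ _).1 h0)
    have h1 : (f : H) = x - (g : H × H).1 := congrArg Prod.fst e
    rw [← sub_add_cancel x (g : H × H).1, ← h1]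
    exact S.domain.add_mem (hTS.1 f.2) hgS
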